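/- Every finite metric space is $\ell_\infty$-super-Ramsey. Precisely: let $\mathcal M$ be a finite metric space, and let $\mathbb R^n_\infty$ denote $\mathbb R^n$ with the maximum metric $\|\mathbf x-\mathbf y\|_\infty=\max_{1\le i\le n}|x_i-y_i|$. Then there are real constants $F_{\mathcal M}\ge\chi_{\mathcal M}>1$, a sequence of nonempty finite sets $V_{\mathcal M}(n)\subset\mathbb R^n_\infty$, and real sequences $\delta_n\to 0$, $\varepsilon_n\to 0$ such that, for every $n$, $|V_{\mathcal M}(n)|\le (F_{\mathcal M}+\delta_n)^n$, and every subset $S\subseteq V_{\mathcal M}(n)$ with $|S|>|V_{\mathcal M}(n)|\,(\chi_{\mathcal M}+\varepsilon_n)^{-n}$ contains a copy of $\mathcal M$, i.e. a subset $T\subseteq S$ for which there is a distance-preserving bijection $\mathcal M\to T$. -/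

import Mathlib

open Filter Topology

/-- A subset `T` of a metric space `X` is a copy of the metric space `M`
if there is a distance-preserving bijection from `M` onto `T`. -/
def IsCopy {X M : Type*} [MetricSpace X] [MetricSpace M] (T : Set X) : Prop :=
  Nonempty (M ≃ᵢ T)

/-- `M` is `ℓ_∞`-super-Ramsey with parameters `F` and `χ`. The type `Fin n → ℝ` carries the
maximum metric, so it is the space `ℝ^n_∞`; the two null sequences `δ`, `ε` are the two `o(1)`
terms. The sets `V n` are required to be nonempty: the empty set would satisfy the last two
conditions for no reason. -/
def IsSuperRamseyWith (M : Type*) [MetricSpace M] (F χ : ℝ) : Prop :=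
  ∃ (V : (n : ℕ) → Finset (Fin n → ℝ)) (δ ε : ℕ → ℝ),
    Tendsto δ atTop (𝓝 0) ∧ Tendsto ε atTop (𝓝 0) ∧
    (∀ n, (V n).Nonempty) ∧
    (∀ n, ((V n).card : ℝ) ≤ (F + δ n) ^ n) ∧
    ∀ n, ∀ S ⊆ V n, ((V n).card : ℝ) * ((χ + ε n) ^ n)⁻¹ < (S.card : ℝ) →
      ∃ T : Set (Fin n → ℝ), T ⊆ (S : Set (Fin n → ℝ)) ∧ IsCopy (M := M) T

/-- `M` is `ℓ_∞`-super-Ramsey. -/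
def IsSuperRamsey (M : Type*) [MetricSpace M] : Prop :=
  ∃ F χ : ℝ, 1 < χ ∧ χ ≤ F ∧ IsSuperRamseyWith M F χ

/-! Place a copy of `M` on a chain of `N + 1` points in `ℓ_∞` whose steps are at most the minimum
distance `m` of `M`, and let `V n` be a power of that chain. Avoiding `M` then costs a factor `N /
(N + 1)` per block of coordinates (`exists_copy_of_pow_lt_card`): moving one step in an extra block
cannot change a maximum that is already at least `m`. The chain is a fine sample of a curve through
the Fréchet embedding of `M` (`exists_chain`). -/

/-- Among the `r`-tuples of points of a chain `p 0, …, p N` whose steps are at most the minimum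
distance of `M`, and which contains a copy of `M`, any `N ^ r + 1` contain a copy of `M`. -/
theorem exists_copy_of_pow_lt_card {M E : Type*} [MetricSpace M] [MetricSpace E] {N : ℕ} {m : ℝ}
    (p : Fin (N + 1) → E) (hp : ∀ j : Fin N, dist (p j.castSucc) (p j.succ) ≤ m)
    (f : M → Fin (N + 1)) (hf : ∀ x y, dist (p (f x)) (p (f y)) = dist x y)
    (hm0 : 0 ≤ m) (hm : ∀ x y : M, x ≠ y → m ≤ dist x y) (r : ℕ) :
    ∀ S : Finset (Fin r → Fin (N + 1)), N ^ r < S.card →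
      ∃ g : M → Fin r → Fin (N + 1), (∀ x, g x ∈ S) ∧
        ∀ x y, dist (p ∘ g x) (p ∘ g y) = dist x y := by
  induction r with
  | zero =>
    intro S hS
    have := S.card_le_univ
    simp at this hS
    omega
  | succ r ih =>
    intro S hS
    have key : ∀ (a b : Fin (N + 1)) (x y : Fin r → Fin (N + 1)),
        dist (p ∘ (Fin.cons a x : Fin (r + 1) → Fin (N + 1)))
          (p ∘ (Fin.cons b y : Fin (r + 1) → Fin (N + 1))) =
        max (dist (p a) (p b)) (dist (p ∘ x) (p ∘ y)) := by
      intro a b x y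
      apply le_antisymm
      · rw [dist_pi_le_iff (le_max_of_le_left dist_nonneg)]
        intro i
        refine Fin.cases ?_ (fun i => ?_) i
        · simp
        · exact le_max_of_le_right (by simpa using dist_le_pi_dist (p ∘ x) (p ∘ y) i)
      · refine max_le ?_ ?_
        · simpa using dist_le_pi_dist (p ∘ (Fin.cons a x : Fin (r + 1) → Fin (N + 1)))
            (p ∘ (Fin.cons b y : Fin (r + 1) → Fin (N + 1))) 0
        · rw [dist_pi_le_iff dist_nonneg]
          intro i
          simpa using dist_le_pi_dist (p ∘ (Fin.cons a x : Fin (r + 1) → Fin (N + 1)))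
            (p ∘ (Fin.cons b y : Fin (r + 1) → Fin (N + 1))) i.succ
    by_cases hfull : ∃ x : Fin r → Fin (N + 1), ∀ a,
        (Fin.cons a x : Fin (r + 1) → Fin (N + 1)) ∈ S
    · obtain ⟨x, hx⟩ := hfull
      refine ⟨fun y => Fin.cons (f y) x, fun y => hx _, fun y z => ?_⟩
      rw [key, hf, dist_self, max_eq_left dist_nonneg]
    · push Not at hfull
      choose h hh using hfull
      classical
      -- The fibre over `x` misses position `h x`; `succAbove` numbers the other `N` positions, and
      -- pigeonhole on that number gives the inductive step.
      let T : Fin N → Finset (Fin r → Fin (N + 1)) := fun j =>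
        Finset.univ.filter fun x =>
          (Fin.cons ((h x).succAbove j) x : Fin (r + 1) → Fin (N + 1)) ∈ S
      have hcover : S ⊆ Finset.univ.biUnion fun j => (T j).image fun x =>
          (Fin.cons ((h x).succAbove j) x : Fin (r + 1) → Fin (N + 1)) := by
        intro s hs
        have hne : s 0 ≠ h (Fin.tail s) := by
          intro e
          apply hh (Fin.tail s)
          rwa [← e, Fin.cons_self_tail]
        obtain ⟨j, hj⟩ := Fin.exists_succAbove_eq hne
        have e : (Fin.cons ((h (Fin.tail s)).succAbove j) (Fin.tail s) :
            Fin (r + 1) → Fin (N + 1)) = s := by rw [hj, Fin.cons_self_tail]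
        simp only [Finset.mem_biUnion, Finset.mem_univ, true_and, Finset.mem_image, T,
          Finset.mem_filter]
        exact ⟨j, Fin.tail s, by rwa [e], e⟩
      have hcard : S.card ≤ ∑ j, (T j).card :=
        (Finset.card_le_card hcover).trans <| Finset.card_biUnion_le.trans <|
          Finset.sum_le_sum fun j _ => Finset.card_image_le
      obtain ⟨j, hj⟩ : ∃ j, N ^ r < (T j).card := by
        by_contra! hle
        have := Finset.sum_le_sum fun j (_ : j ∈ Finset.univ) => hle j
        simp only [Finset.sum_const, Finset.card_univ, Fintype.card_fin, smul_eq_mul] at this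
        rw [pow_succ'] at hS
        omega
      obtain ⟨g, hgS, hg⟩ := ih (T j) hj
      refine ⟨fun x => Fin.cons ((h (g x)).succAbove j) (g x), fun x => ?_, fun x y => ?_⟩
      · exact (Finset.mem_filter.1 (hgS x)).2
      · rcases eq_or_ne x y with rfl | hxy
        · simp
        · rw [key, hg]
          refine max_eq_right (le_trans ?_ (hm x y hxy))
          -- Whatever the gap, the first coordinate is `j` or `j + 1`, so any two differ by at most
          -- one step.
          have hor : ∀ a : Fin (N + 1), a.succAbove j = j.castSucc ∨ a.succAbove j = j.succ :=
            fun a => ite_eq_or_eq _ _ _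
          rcases hor (h (g x)) with e | e <;> rcases hor (h (g y)) with e' | e' <;>
          rw [e, e']
          · simpa
          · exact hp j
          · rw [dist_comm]; exact hp j
          · simpa

/-- The Fréchet embedding of a finite metric space is isometric for the maximum metric. -/
theorem dist_frechet_embedding {M : Type*} [MetricSpace M] [Fintype M] (x y : M) :
    dist (fun z => dist x z) (fun z => dist y z) = dist x y := by
  apply le_antisymm
  · rw [dist_pi_le_iff dist_nonneg]
    intro z
    rw [Real.dist_eq]
    exact abs_dist_sub_le x y z
  · have := dist_le_pi_dist (fun z => dist x z) (fun z => dist y z) y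
    simpa using this

theorem exists_pos_le_dist (M : Type*) [MetricSpace M] [Finite M] :
    ∃ m : ℝ, 0 < m ∧ ∀ x y : M, x ≠ y → m ≤ dist x y := by
  rcases ({q | q.1 ≠ q.2} : Set (M × M)).eq_empty_or_nonempty with h | h
  · refine ⟨1, one_pos, fun x y hxy => ?_⟩
    have : (x, y) ∈ ({q | q.1 ≠ q.2} : Set (M × M)) := hxy
    simp [h] at this
  · obtain ⟨q, hq, hmin⟩ := Set.exists_min_image _ (fun q : M × M => dist q.1 q.2)
      (Set.toFinite _) h
    exact ⟨_, dist_pos.2 hq, fun x y hxy => hmin (x, y) hxy⟩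

/-- A finite metric space lies in a chain of distinct points of some `ℓ_∞` space, with steps as
short as desired up to the minimum distance. -/
theorem exists_chain (M : Type*) [MetricSpace M] [Fintype M] {m : ℝ} (hm0 : 0 < m)
    (hm : ∀ x y : M, x ≠ y → m ≤ dist x y) :
    ∃ (N : ℕ) (p : Fin (N + 1) → Option M → ℝ) (f : M → Fin (N + 1)), 1 ≤ N ∧
      Function.Injective p ∧ (∀ j : Fin N, dist (p j.castSucc) (p j.succ) ≤ m) ∧
      ∀ x y, dist (p (f x)) (p (f y)) = dist x y := by
  classical
  let e := Fintype.equivFin M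
  let s := Fintype.card M
  let v : M → ℝ := fun x => (e x : ℕ)
  have hv : Function.Injective v := fun x y h => e.injective (Fin.ext (Nat.cast_injective h))
  let P : M → Polynomial ℝ := fun z => Lagrange.interpolate Finset.univ v fun x => dist x z
  have hP : ∀ x z, (P z).eval (v x) = dist x z := fun x z =>
    Lagrange.eval_interpolate_at_node _ hv.injOn (Finset.mem_univ x)
  -- The coordinate `none` makes the curve injective; its slope keeps its variation on `[0, s]`
  -- below `m`, so distances within `M` survive.
  let γ : ℝ → Option M → ℝ := fun t o => o.elim (m / (s + 1) * t) fun z => (P z).eval t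
  have hγ : Continuous γ := by
    refine continuous_pi fun o => ?_
    cases o with
    | none => exact continuous_const.mul continuous_id
    | some z => exact (P z).continuous
  have huc := (isCompact_Icc (a := (0 : ℝ)) (b := s + 1)).uniformContinuousOn_of_continuous
    hγ.continuousOn
  obtain ⟨d, hd0, hd⟩ := Metric.uniformContinuousOn_iff.1 huc m hm0
  obtain ⟨q, hq⟩ := exists_nat_one_div_lt hd0
  set Q : ℝ := (q : ℝ) + 1 with hQ
  have hQ0 : 0 < Q := by positivity
  have hs0 : (0 : ℝ) < (s : ℝ) + 1 := by positivity
  have hidx : ∀ x, (e x : ℕ) * (q + 1) < (s + 1) * (q + 1) + 1 := fun x => by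
    have := Nat.mul_le_mul_right (q + 1) (e x).2.le
    have h2 : s * (q + 1) ≤ (s + 1) * (q + 1) := Nat.mul_le_mul_right _ (by omega)
    exact Nat.lt_succ_of_le (this.trans h2)
  have hval : ∀ x, (((e x : ℕ) * (q + 1) : ℕ) : ℝ) / Q = v x := fun x => by
    push_cast
    rw [← hQ, mul_div_assoc, div_self hQ0.ne', mul_one]
  -- Mesh `1 / (q + 1)` hits the integer times, where the points of `M` lie. Running to `s + 1`
  -- gives `1 ≤ N` even for empty `M`.
  refine ⟨(s + 1) * (q + 1), fun i => γ ((i : ℕ) / Q), fun x => ⟨_, hidx x⟩, ?_, ?_, ?_, ?_⟩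
  · exact Nat.succ_le_of_lt (by positivity)
  · intro i j hij
    have h := congrFun hij none
    have hc : m / ((s : ℝ) + 1) ≠ 0 := by positivity
    have h2 := mul_left_cancel₀ hc h
    rw [div_left_inj' hQ0.ne'] at h2
    exact Fin.ext (by exact_mod_cast h2)
  · intro j
    have hmem : ∀ i : ℕ, i ≤ (s + 1) * (q + 1) → (i : ℝ) / Q ∈ Set.Icc (0 : ℝ) (s + 1) := by
      intro i hi
      refine ⟨by positivity, ?_⟩
      rw [div_le_iff₀ hQ0]
      rw [hQ]
      exact_mod_cast hi
    refine (hd _ (hmem _ j.2.le) _ (hmem _ j.2) ?_).le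
    rw [Real.dist_eq, ← sub_div]
    simpa [neg_div, abs_of_pos hQ0] using hq
  · intro x y
    simp only [hval]
    rcases eq_or_ne x y with rfl | hxy
    · simp
    apply le_antisymm
    · rw [dist_pi_le_iff dist_nonneg]
      intro o
      cases o with
      | none =>
        refine le_trans ?_ (hm x y hxy)
        change dist (m / (s + 1) * v x) (m / (s + 1) * v y) ≤ m
        have hx : v x ∈ Set.Icc (0 : ℝ) s :=
          ⟨Nat.cast_nonneg _, Nat.cast_le.2 (e x).2.le⟩
        have hy : v y ∈ Set.Icc (0 : ℝ) s :=
          ⟨Nat.cast_nonneg _, Nat.cast_le.2 (e y).2.le⟩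
        have := Real.dist_le_of_mem_Icc hx hy
        rw [Real.dist_eq] at this ⊢
        rw [← mul_sub, abs_mul, abs_of_pos (by positivity : 0 < m / ((s : ℝ) + 1)),
          div_mul_eq_mul_div, div_le_iff₀ hs0]
        exact mul_le_mul_of_nonneg_left (by linarith) hm0.le
      | some z =>
        change dist ((P z).eval (v x)) ((P z).eval (v y)) ≤ _
        rw [hP, hP, ← dist_frechet_embedding x y]
        exact dist_le_pi_dist (fun z => dist x z) (fun z => dist y z) z
    · have := dist_le_pi_dist (γ (v x)) (γ (v y)) (some y)
      change dist ((P y).eval (v x)) ((P y).eval (v y)) ≤ _ at this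
      rwa [hP, hP, dist_self, Real.dist_0_eq_abs, abs_of_nonneg dist_nonneg] at this

/-- Extending families by zero is isometric for the maximum metric. -/
theorem exists_isometry_block {κ : Type*} [Fintype κ] {r n : ℕ} (h : r * Fintype.card κ ≤ n) :
    ∃ Φ : (Fin r → κ → ℝ) → (Fin n → ℝ), Isometry Φ := by
  obtain ⟨ι⟩ := Function.Embedding.nonempty_of_card_le (α := Fin r × κ) (β := Fin n) (by simpa)
  refine ⟨fun u => Function.extend ι (fun q => u q.1 q.2) 0, Isometry.of_dist_eq fun u w => ?_⟩
  apply le_antisymm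
  · rw [dist_pi_le_iff dist_nonneg]
    intro i
    by_cases hi : ∃ q, ι q = i
    · obtain ⟨q, rfl⟩ := hi
      rw [ι.injective.extend_apply, ι.injective.extend_apply]
      exact (dist_le_pi_dist (u q.1) (w q.1) q.2).trans (dist_le_pi_dist u w q.1)
    · rw [Function.extend_apply' _ _ _ hi, Function.extend_apply' _ _ _ hi, dist_self]
      exact dist_nonneg
  · rw [dist_pi_le_iff dist_nonneg]
    intro a
    rw [dist_pi_le_iff dist_nonneg]
    intro b
    have := dist_le_pi_dist (Function.extend ι (fun q => u q.1 q.2) 0)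
      (Function.extend ι (fun q => w q.1 q.2) 0) (ι (a, b))
    rwa [ι.injective.extend_apply, ι.injective.extend_apply] at this

theorem theorem2 (M : Type*) [MetricSpace M] [Finite M] : IsSuperRamsey M := by
  classical
  have := Fintype.ofFinite M
  obtain ⟨m, hm0, hm⟩ := exists_pos_le_dist M
  obtain ⟨N, p, f, hN, hpinj, hp, hf⟩ := exists_chain M hm0 hm
  set k := Fintype.card (Option M) with hk
  have hk0 : 0 < k := Fintype.card_pos
  have hN0 : (0 : ℝ) < N := by exact_mod_cast hN
  have hN1 : (1 : ℝ) ≤ N := by exact_mod_cast hN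
  set c : ℝ := (N + 1) / N with hc
  have hc1 : 1 < c := by rw [hc, one_lt_div hN0]; linarith
  -- The 2 absorbs the rounding in `n / k`: `n ≤ 2 * k * (n / k)` once `k ≤ n`.
  set χ : ℝ := c ^ (((2 * k : ℕ) : ℝ)⁻¹) with hχ
  have hχ1 : 1 < χ := Real.one_lt_rpow hc1 (by positivity)
  have hχc : χ ^ (2 * k) = c := Real.rpow_inv_natCast_pow (by linarith) (by omega)
  have hχF : χ ≤ N + 1 :=
    calc χ ≤ χ ^ (2 * k) := le_self_pow₀ hχ1.le (by omega)
      _ = c := hχc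
      _ ≤ N + 1 := div_le_self (by linarith) hN1
  choose Φ hΦ using fun n : ℕ =>
    exists_isometry_block (κ := Option M) (r := n / k) (n := n) (Nat.div_mul_le_self n k)
  let ψ : (n : ℕ) → (Fin (n / k) → Fin (N + 1)) → (Fin n → ℝ) := fun n x => Φ n (p ∘ x)
  have hψ : ∀ n, Function.Injective (ψ n) := fun n =>
    (hΦ n).injective.comp hpinj.comp_left
  let V : (n : ℕ) → Finset (Fin n → ℝ) := fun n => Finset.univ.image (ψ n)
  have hV : ∀ n, ((V n).card : ℝ) = (N + 1) ^ (n / k) := fun n => by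
    rw [Finset.card_image_of_injective _ (hψ n)]
    simp
  -- For `n < k` the base `χ + ε n` is 1, so no `S ⊆ V n` is large enough.
  refine ⟨N + 1, χ, hχ1, hχF, V, 0, fun n => if n < k then 1 - χ else 0, tendsto_const_nhds,
    ?_, fun n => ?_, fun n => ?_, fun n S hS hlt => ?_⟩
  · refine tendsto_const_nhds.congr' ?_
    filter_upwards [eventually_ge_atTop k] with n hn
    rw [if_neg (by omega)]
  · exact Finset.univ_nonempty.image _
  · rw [hV, Pi.zero_apply, add_zero]
    exact pow_le_pow_right₀ (by linarith) (Nat.div_le_self n k)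
  · have hnk : ¬ n < k := by
      intro hn
      simp only [if_pos hn, add_sub_cancel, one_pow, inv_one, mul_one] at hlt
      exact absurd (Finset.card_le_card hS) (by exact_mod_cast hlt.not_ge)
    simp only [if_neg hnk, add_zero, hV] at hlt
    have hexp : n ≤ 2 * k * (n / k) := by
      have h1 : 1 ≤ n / k := (Nat.one_le_div_iff hk0).2 (by omega)
      have h2 := Nat.div_add_mod n k
      have h3 := Nat.mod_lt n hk0
      have h4 : k * 1 ≤ k * (n / k) := Nat.mul_le_mul_left k h1
      rw [mul_assoc]
      omega
    have hpow : χ ^ n ≤ ((N + 1) / N) ^ (n / k) := by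
      rw [← hc, ← hχc, ← pow_mul]
      exact pow_le_pow_right₀ hχ1.le hexp
    have hbig : (N : ℝ) ^ (n / k) < S.card := by
      refine lt_of_le_of_lt ?_ hlt
      rw [← div_eq_mul_inv, le_div_iff₀ (by positivity)]
      calc (N : ℝ) ^ (n / k) * χ ^ n ≤ N ^ (n / k) * ((N + 1) / N) ^ (n / k) := by gcongr
        _ = (N + 1) ^ (n / k) := by rw [← mul_pow, mul_div_cancel₀ _ hN0.ne']
    let S' := Finset.univ.filter fun x => ψ n x ∈ S
    have hS' : S'.image (ψ n) = S := by
      ext s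
      simp only [Finset.mem_image, S', Finset.mem_filter, Finset.mem_univ, true_and]
      refine ⟨fun ⟨x, hx, e⟩ => e ▸ hx, fun hs => ?_⟩
      obtain ⟨x, -, rfl⟩ := Finset.mem_image.1 (hS hs)
      exact ⟨x, hs, rfl⟩
    have hcard : N ^ (n / k) < S'.card := by
      rw [← hS', Finset.card_image_of_injective _ (hψ n)] at hbig
      exact_mod_cast hbig
    obtain ⟨g, hgS, hg⟩ := exists_copy_of_pow_lt_card p hp f hf hm0.le hm _ S' hcard
    have hiso : Isometry fun x => ψ n (g x) := Isometry.of_dist_eq fun x y => by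
      rw [← hg x y]
      exact (hΦ n).dist_eq _ _
    refine ⟨Set.range fun x => ψ n (g x), ?_, ⟨hiso.isometryEquivOnRange⟩⟩
    rintro _ ⟨x, rfl⟩
    exact (Finset.mem_filter.1 (hgS x)).2
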